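/- **Setting.** Let $X=[\underline x,\bar x]$, $\Theta=[\underline\theta,\bar\theta]$ with $0<\underline\theta<\bar\theta<1$, and let $F$ be a probability distribution on $\Theta$ with an everywhere positive density $f$. Let $\Delta(X)$ be the set of Borel probability measures on $X$. Let $u:\mathbb R\to\mathbb R$ be strictly increasing, continuous and strictly concave, $K:\mathbb R\to\mathbb R$ strictly increasing and convex, $z:X\to\mathbb R$ differentiable, strictly increasing and convex, and let $$C(\theta,\mu)=(1-\theta)\,K\Big(\int_X z\,d\mu\Big),\qquad U(\theta,w,\mu)=\int_X u(w(x))\,\mu(dx)-C(\theta,\mu).$$ A mechanism $\{w_\theta,\mu_\theta\}_{\theta\in\Theta}$ consists of a non-decreasing right-continuous wage function $w_\theta:X\to\mathbb R$ and a measure $\mu_\theta\in\Delta(X)$ for each $\theta\in\Theta$. It is incentive compatible if $U(\theta,w_\theta,\mu_\theta)\ge U(\theta,w_{\hat\theta},\mu')$ for all $\theta,\hat\theta\in\Theta$ and $\mu'\in\Delta(X)$, and individually rational if $U(\theta,w_\theta,\mu_\theta)\ge 0$ for all $\theta\in\Theta$. It is optimal if it maximizes the principal's expected payoff $\int_\Theta\int_X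 (x-w_\theta(x))\,\mu_\theta(dx)\,dF(\theta)$ among all incentive compatible and individually rational mechanisms for which $\theta\mapsto\int_X (x-w_\theta(x))\,\mu_\theta(dx)$ is $F$-integrable (the optimal mechanism being one of them). **Proposition.** In any optimal mechanism $\{w_\theta,\mu_\theta\}_{\theta\in\Theta}$, for Lebesgue-almost every $\theta\in\Theta$ the measure $\mu_\theta$ is a Dirac measure $\delta_{x_\theta}$ for some $x_\theta\in X$. Moreover, there is an optimal mechanism $\{w'_\theta,\mu'_\theta\}_{\theta\in\Theta}$ in which $\mu'_\theta$ is a Dirac measure for every $\theta\in\Theta$, and $w'_\theta=w_\theta$, $\mu'_\theta=\mu_\theta$ at every $\theta$ at which $\mu_\theta$ is already a Dirac measure. -/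

import Mathlib

open MeasureTheory Set

noncomputable section

/-- A direct mechanism with type space `Θ` and output space `X`: for each (reported) type a wage
contract, required to be a non-decreasing and right-continuous function of output, and a
recommended output distribution. -/
structure Mechanism (Θ X : Type*) [TopologicalSpace X] [Preorder X] [MeasurableSpace X] where
  /-- the wage contract offered after each report -/
  wage : Θ → X → ℝ
  /-- wages are non-decreasing in output -/
  wage_mono : ∀ θ, Monotone (wage θ)
  /-- wages are right-continuous in output -/
  wage_rightCts : ∀ θ x, ContinuousWithinAt (wage θ) (Ici x) x
  /-- the recommended output distribution for each type -/
  action : Θ → ProbabilityMeasure X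

/-- The expected utility of type `θ` with utility function `u` and cost function `C`, who holds
contract `w` and chooses the output distribution `μ`. -/
def agentUtility {Θ X : Type*} [MeasurableSpace X] (u : ℝ → ℝ)
    (C : Θ → ProbabilityMeasure X → ℝ) (θ : Θ) (w : X → ℝ) (μ : ProbabilityMeasure X) : ℝ :=
  (∫ x, u (w x) ∂(μ : Measure X)) - C θ μ

namespace Mechanism

/-- Incentive compatibility: truthful reporting followed by obedience is at least as good as any
joint deviation in report and output distribution. -/
def IncentiveCompatible {Θ X : Type*} [TopologicalSpace X] [Preorder X] [MeasurableSpace X]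
    (M : Mechanism Θ X) (u : ℝ → ℝ) (C : Θ → ProbabilityMeasure X → ℝ) : Prop :=
  ∀ (θ θ' : Θ) (ν : ProbabilityMeasure X),
    agentUtility u C θ (M.wage θ') ν ≤ agentUtility u C θ (M.wage θ) (M.action θ)

/-- Participation: every type gets at least the outside option, which is worth `0`. -/
def IndividuallyRational {Θ X : Type*} [TopologicalSpace X] [Preorder X] [MeasurableSpace X]
    (M : Mechanism Θ X) (u : ℝ → ℝ) (C : Θ → ProbabilityMeasure X → ℝ) : Prop :=
  ∀ θ : Θ, 0 ≤ agentUtility u C θ (M.wage θ) (M.action θ)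

/-- The expected payoff (output minus wage) that the risk-neutral principal gets from type `θ`,
where output lies in `[xlo, xhi]`. -/
def payoffAt {Θ : Type*} {xlo xhi : ℝ} (M : Mechanism Θ (Icc xlo xhi)) (θ : Θ) : ℝ :=
  ∫ x : Icc xlo xhi, ((x : ℝ) - M.wage θ x) ∂(M.action θ : Measure (Icc xlo xhi))

/-- Feasible mechanisms: incentive compatible, individually rational, and with a well-defined
finite expected payoff of the principal under the distribution `F` of types. -/
def Feasible {Θ : Type*} [MeasurableSpace Θ] {xlo xhi : ℝ} (M : Mechanism Θ (Icc xlo xhi))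
    (u : ℝ → ℝ) (C : Θ → ProbabilityMeasure (Icc xlo xhi) → ℝ) (F : Measure Θ) : Prop :=
  M.IncentiveCompatible u C ∧ M.IndividuallyRational u C ∧ Integrable M.payoffAt F

/-- Optimal mechanisms: feasible, and with the greatest expected payoff of the principal among
all feasible mechanisms. -/
def Optimal {Θ : Type*} [MeasurableSpace Θ] {xlo xhi : ℝ} (M : Mechanism Θ (Icc xlo xhi))
    (u : ℝ → ℝ) (C : Θ → ProbabilityMeasure (Icc xlo xhi) → ℝ) (F : Measure Θ) : Prop :=
  M.Feasible u C F ∧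
    ∀ M' : Mechanism Θ (Icc xlo xhi), M'.Feasible u C F →
      ∫ θ, M'.payoffAt θ ∂F ≤ ∫ θ, M.payoffAt θ ∂F

end Mechanism

/-- `μ` is a Dirac measure: all of its mass is at one point. -/
def IsDirac {X : Type*} [MeasurableSpace X] (μ : ProbabilityMeasure X) : Prop :=
  ∃ x : X, (μ : Measure X) = Measure.dirac x

/-- The cost function `C(θ, μ) = (1 - θ) K(∫ z dμ)`. -/
def meanCost {θlo θhi xlo xhi : ℝ} (K z : ℝ → ℝ) (θ : Icc θlo θhi)
    (μ : ProbabilityMeasure (Icc xlo xhi)) : ℝ :=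
  (1 - (θ : ℝ)) * K (∫ x : Icc xlo xhi, z (x : ℝ) ∂(μ : Measure (Icc xlo xhi)))

/-- The distribution on `[θlo, θhi]` with density `f` with respect to Lebesgue measure. -/
def typeDistribution {θlo θhi : ℝ} (f : Icc θlo θhi → ℝ) : Measure (Icc θlo θhi) :=
  (Measure.comap Subtype.val (volume : Measure ℝ)).withDensity (fun θ => ENNReal.ofReal (f θ))

end

open MeasureTheory Set

/-! ### Means of monotone functions on a compact interval. -/

section MonotoneIntegral

variable {a b : ℝ}

/-! Cost depends on a lottery only through its mean of `z`. Replace a non-Dirac `μ` by the sure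
output `x` with `z x = ∫ z dμ`, paid the certainty equivalent `c` from `x` on and the lowest
original wage below. The type's utility is unchanged. No type gains a new deviation, since any
lottery against the step contract is matched, at no higher cost, by a mixture of `μ` and the lowest
output against the old contract (`exists_deviation`).

The principal gains strictly (`payoff_lt_of_not_isDirac`): Jensen for `z` makes the mean of `μ` at
most `x`, and strict Jensen for `u` makes `c` less than the mean wage unless the wage is constant
`μ`-a.e. In that case incentive compatibility rules out mass on outputs cheaper than `x`, so `μ`
would be Dirac. Optimality then confines the non-Dirac types to a null set. -/

theorem Monotone.integrable_Icc (hab : a ≤ b) {g : Icc a b → ℝ} (hg : Monotone g)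
    (μ : Measure (Icc a b)) [IsFiniteMeasure μ] : Integrable g μ :=
  Integrable.of_mem_Icc (g ⟨a, left_mem_Icc.2 hab⟩) (g ⟨b, right_mem_Icc.2 hab⟩)
    hg.measurable.aemeasurable (ae_of_all _ fun x => ⟨hg x.2.1, hg x.2.2⟩)

theorem Monotone.left_le_integral (hab : a ≤ b) {g : Icc a b → ℝ} (hg : Monotone g)
    (μ : Measure (Icc a b)) [IsProbabilityMeasure μ] :
    g ⟨a, left_mem_Icc.2 hab⟩ ≤ ∫ x, g x ∂μ := by
  have h := integral_mono (μ := μ) (integrable_const (g ⟨a, left_mem_Icc.2 hab⟩))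
    (hg.integrable_Icc hab μ) (fun x => hg x.2.1)
  simpa using h

theorem Monotone.integral_le_right (hab : a ≤ b) {g : Icc a b → ℝ} (hg : Monotone g)
    (μ : Measure (Icc a b)) [IsProbabilityMeasure μ] :
    ∫ x, g x ∂μ ≤ g ⟨b, right_mem_Icc.2 hab⟩ := by
  have h := integral_mono (μ := μ) (hg.integrable_Icc hab μ)
    (integrable_const (g ⟨b, right_mem_Icc.2 hab⟩)) (fun x => hg x.2.2)
  simpa using h

/-- A monotone continuous function on a compact interval attains its mean. -/
theorem Monotone.exists_eq_integral (hab : a ≤ b) {g : Icc a b → ℝ} (hg : Monotone g)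
    (hgc : Continuous g) (μ : Measure (Icc a b)) [IsProbabilityMeasure μ] :
    ∃ x, g x = ∫ y, g y ∂μ := by
  have : PreconnectedSpace (Icc a b) := Subtype.preconnectedSpace isPreconnected_Icc
  exact mem_range_of_exists_le_of_exists_ge hgc ⟨_, hg.left_le_integral hab μ⟩
    ⟨_, hg.integral_le_right hab μ⟩

/-- Certainty equivalents exist. -/
theorem Monotone.exists_certaintyEquivalent (hab : a ≤ b) {u : ℝ → ℝ} (hu : Monotone u)
    (huc : Continuous u) {w : Icc a b → ℝ} (hw : Monotone w)
    (μ : Measure (Icc a b)) [IsProbabilityMeasure μ] :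
    ∃ c, u c = ∫ y, u (w y) ∂μ :=
  mem_range_of_exists_le_of_exists_ge huc ⟨_, (hu.comp hw).left_le_integral hab μ⟩
    ⟨_, (hu.comp hw).integral_le_right hab μ⟩

end MonotoneIntegral

theorem MeasureTheory.Measure.eq_dirac_of_ae_eq {α : Type*} [MeasurableSpace α] {μ : Measure α}
    [IsProbabilityMeasure μ] {x : α} (h : ∀ᵐ y ∂μ, y = x) : μ = Measure.dirac x := by
  have h1 : μ.map id = μ.map (fun _ => x) := Measure.map_congr h
  simpa using h1

/-- If a real function is at least its mean almost everywhere, it is constant almost everywhere. -/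
theorem MeasureTheory.ae_eq_integral_of_ae_integral_le {α : Type*} [MeasurableSpace α]
    {μ : Measure α} [IsProbabilityMeasure μ] {g : α → ℝ} (hg : Integrable g μ)
    (h : ∀ᵐ y ∂μ, ∫ x, g x ∂μ ≤ g y) : ∀ᵐ y ∂μ, g y = ∫ x, g x ∂μ := by
  have h1 := (integral_eq_iff_of_ae_le (integrable_const (∫ x, g x ∂μ)) hg h).1 (by simp)
  filter_upwards [h1] with y hy using hy.symm

/-- Paying `c` for outputs from `x` on, and `l` below `x`. -/
def stepWage {X : Type*} [LinearOrder X] (l c : ℝ) (x y : X) : ℝ := if x ≤ y then c else l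

section StepWage

variable {X : Type*} [LinearOrder X] {l c : ℝ}

theorem stepWage_self (l c : ℝ) (x : X) : stepWage l c x x = c := if_pos le_rfl

theorem stepWage_monotone (h : l ≤ c) (x : X) : Monotone (stepWage l c x) := by
  intro y y' hy
  unfold stepWage
  split_ifs with h1 h2
  · exact le_rfl
  · exact absurd (h1.trans hy) h2
  · exact h
  · exact le_rfl

theorem stepWage_rightCts [TopologicalSpace X] [OrderTopology X] (l c : ℝ) (x y : X) :
    ContinuousWithinAt (stepWage l c x) (Ici y) y := by
  rcases le_or_gt x y with h | h
  · refine (continuousWithinAt_const (b := c)).congr (fun t ht => ?_) (if_pos h)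
    exact if_pos (h.trans ht)
  · refine ContinuousAt.continuousWithinAt ?_
    refine (continuousAt_const (y := l)).congr ?_
    filter_upwards [Iio_mem_nhds h] with t ht
    exact (if_neg (not_le.2 ht)).symm

end StepWage

/-! ### The two effects of replacing a lottery: on incentives and on the principal's payoff. -/

section Deviation

variable {xlo xhi : ℝ}

/-- Whatever can be achieved against the step contract at `x`, which pays the certainty equivalent
of `μ` from `x` on, can be achieved at no higher cost against the original contract. -/
theorem exists_deviation (hx : xlo ≤ xhi) {v Z s : Icc xlo xhi → ℝ} (hv : Monotone v)
    (hZ : Monotone Z) {x : Icc xlo xhi} (μ ν : ProbabilityMeasure (Icc xlo xhi))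
    (hZx : Z x = ∫ y, Z y ∂(μ : Measure (Icc xlo xhi)))
    (hs : ∀ y, s y = if x ≤ y then ∫ t, v t ∂(μ : Measure (Icc xlo xhi))
      else v ⟨xlo, left_mem_Icc.2 hx⟩) :
    ∃ ν' : ProbabilityMeasure (Icc xlo xhi),
      ∫ y, v y ∂(ν' : Measure (Icc xlo xhi)) = ∫ y, s y ∂(ν : Measure (Icc xlo xhi)) ∧
      ∫ y, Z y ∂(ν' : Measure (Icc xlo xhi)) ≤ ∫ y, Z y ∂(ν : Measure (Icc xlo xhi)) := by
  set x₀ : Icc xlo xhi := ⟨xlo, left_mem_Icc.2 hx⟩ with hx₀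
  set A : Set (Icc xlo xhi) := Ici x with hA
  have hAm : MeasurableSet A := measurableSet_Ici
  -- The matching deviation: play `μ` with the probability that `ν` reaches `x`, and the lowest
  -- output otherwise.
  let m : Measure (Icc xlo xhi) :=
    (ν : Measure (Icc xlo xhi)) A • (μ : Measure (Icc xlo xhi)) +
      (ν : Measure (Icc xlo xhi)) Aᶜ • Measure.dirac x₀
  have hm : IsProbabilityMeasure m := ⟨by
    simp only [m, Measure.add_apply, Measure.smul_apply, measure_univ, smul_eq_mul, mul_one]
    exact prob_add_prob_compl hAm⟩
  have hint : ∀ g : Icc xlo xhi → ℝ, Monotone g → ∫ y, g y ∂m =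
      (ν : Measure (Icc xlo xhi)).real A * ∫ y, g y ∂(μ : Measure (Icc xlo xhi)) +
      (ν : Measure (Icc xlo xhi)).real Aᶜ * g x₀ := by
    intro g hg
    have h1 : Integrable g ((ν : Measure (Icc xlo xhi)) A • (μ : Measure (Icc xlo xhi))) :=
      (hg.integrable_Icc hx _).smul_measure (measure_ne_top _ _)
    have h2 : Integrable g ((ν : Measure (Icc xlo xhi)) Aᶜ • Measure.dirac x₀) :=
      (hg.integrable_Icc hx _).smul_measure (measure_ne_top _ _)
    rw [integral_add_measure h1 h2, integral_smul_measure, integral_smul_measure, integral_dirac]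
    rfl
  have hstep : ∀ p q : ℝ, Integrable (fun y => if x ≤ y then p else q)
      (ν : Measure (Icc xlo xhi)) ∧
      ∫ y, (if x ≤ y then p else q) ∂(ν : Measure (Icc xlo xhi)) =
      (ν : Measure (Icc xlo xhi)).real A * p + (ν : Measure (Icc xlo xhi)).real Aᶜ * q := by
    intro p q
    have he : (fun y => if x ≤ y then p else q) =
        fun y => A.indicator (fun _ => p) y + Aᶜ.indicator (fun _ => q) y := by
      funext y
      by_cases h : x ≤ y
      · simp [hA, h]
      · simp [hA, h, not_le.1 h]
    have h1 : Integrable (A.indicator fun _ => p) (ν : Measure (Icc xlo xhi)) :=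
      (integrable_const p).indicator hAm
    have h2 : Integrable (Aᶜ.indicator fun _ => q) (ν : Measure (Icc xlo xhi)) :=
      (integrable_const q).indicator hAm.compl
    rw [he]
    refine ⟨h1.add h2, ?_⟩
    rw [integral_add h1 h2, integral_indicator_const _ hAm, integral_indicator_const _ hAm.compl]
    rfl
  refine ⟨⟨m, hm⟩, ?_, ?_⟩
  · simp only [ProbabilityMeasure.coe_mk, hs]
    rw [hint v hv, (hstep _ _).2]
  · simp only [ProbabilityMeasure.coe_mk]
    -- The cost index of `m` is the `ν`-mean of a step function lying below `Z`.
    rw [hint Z hZ, ← hZx, ← (hstep (Z x) (Z x₀)).2]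
    refine integral_mono (hstep _ _).1 (hZ.integrable_Icc hx _) fun y => ?_
    dsimp only
    split_ifs with h
    · exact hZ h
    · exact hZ y.2.1

/-- If every certain output cheaper than the lottery `μ` yields strictly less utility than `μ`, then
the principal strictly prefers to `μ` the certain output of the same cost, paid its certainty
equivalent. -/
theorem payoff_lt_of_not_isDirac (hx : xlo ≤ xhi) {u : ℝ → ℝ}
    (hu_mono : StrictMono u) (hu_cont : Continuous u) (hu_conc : StrictConcaveOn ℝ univ u)
    {z : ℝ → ℝ} (hz_cont : ContinuousOn z (Icc xlo xhi)) (hz_mono : StrictMonoOn z (Icc xlo xhi))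
    (hz_conv : ConvexOn ℝ (Icc xlo xhi) z) {w : Icc xlo xhi → ℝ} (hw : Monotone w)
    {μ : ProbabilityMeasure (Icc xlo xhi)} (hμ : ¬ IsDirac μ) {x : Icc xlo xhi}
    (hzx : z x = ∫ y : Icc xlo xhi, z y ∂(μ : Measure (Icc xlo xhi))) {c : ℝ}
    (hc : u c = ∫ y, u (w y) ∂(μ : Measure (Icc xlo xhi)))
    (hopt : ∀ y : Icc xlo xhi, z y < z x →
      u (w y) < ∫ y, u (w y) ∂(μ : Measure (Icc xlo xhi))) :
    ∫ y : Icc xlo xhi, ((y : ℝ) - w y) ∂(μ : Measure (Icc xlo xhi)) < x - c := by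
  have hval : Monotone (fun y : Icc xlo xhi => (y : ℝ)) := Subtype.mono_coe _
  have hZ : Monotone (fun y : Icc xlo xhi => z y) :=
    fun y y' h => hz_mono.monotoneOn y.2 y'.2 h
  have hvi := hval.integrable_Icc hx (μ : Measure (Icc xlo xhi))
  have hwi := hw.integrable_Icc hx (μ : Measure (Icc xlo xhi))
  have hZi := hZ.integrable_Icc hx (μ : Measure (Icc xlo xhi))
  have hui := (hu_mono.monotone.comp hw).integrable_Icc hx (μ : Measure (Icc xlo xhi))
  rw [integral_sub hvi hwi]
  have hmem : ∫ y : Icc xlo xhi, (y : ℝ) ∂(μ : Measure (Icc xlo xhi)) ∈ Icc xlo xhi :=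
    ⟨hval.left_le_integral hx _, hval.integral_le_right hx _⟩
  have h1 : ∫ y : Icc xlo xhi, (y : ℝ) ∂(μ : Measure (Icc xlo xhi)) ≤ x := by
    refine (hz_mono.le_iff_le hmem x.2).1 ?_
    rw [hzx]
    exact hz_conv.map_integral_le hz_cont isClosed_Icc (ae_of_all _ fun y => y.2) hvi hZi
  have h2 : c < ∫ y, w y ∂(μ : Measure (Icc xlo xhi)) := by
    rcases hu_conc.ae_eq_const_or_lt_map_average hu_cont.continuousOn isClosed_univ
      (ae_of_all _ fun y => mem_univ (w y)) hwi hui with h | h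
    -- With a constant wage, a cheaper output would earn less than that constant, so a.e. `z` is at
    -- least its mean, hence equal to it.
    · exfalso
      rw [average_eq_integral] at h
      have hcw : c = ∫ y, w y ∂(μ : Measure (Icc xlo xhi)) := by
        refine hu_mono.injective ?_
        rw [hc, integral_congr_ae (h.mono fun y hy => congrArg u hy)]
        simp
      have h3 : ∀ᵐ y : Icc xlo xhi ∂(μ : Measure (Icc xlo xhi)),
          ∫ y : Icc xlo xhi, z y ∂(μ : Measure (Icc xlo xhi)) ≤ z y := by
        filter_upwards [h] with y hy
        by_contra hlt
        rw [not_le, ← hzx] at hlt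
        have h4 := hopt y hlt
        rw [← hc, hcw, hy] at h4
        exact lt_irrefl _ h4
      refine hμ ⟨x, Measure.eq_dirac_of_ae_eq ?_⟩
      filter_upwards [ae_eq_integral_of_ae_integral_le hZi h3] with y hy
      exact Subtype.ext (hz_mono.injOn y.2 x.2 (hy.trans hzx.symm))
    · rw [average_eq_integral, average_eq_integral, ← hc] at h
      exact hu_mono.lt_iff_lt.1 h
  linarith

end Deviation

/-- Under incentive compatibility for linear type-dependence `B - (1 - θ) k`, the cost index and
the gross utility are both non-decreasing in the type. -/
theorem monotone_of_linear_incentive {Θ : Set ℝ} (hΘ : ∀ θ ∈ Θ, θ < 1) {B k : Θ → ℝ}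
    (h : ∀ θ θ' : Θ, B θ' - (1 - (θ : ℝ)) * k θ' ≤ B θ - (1 - (θ : ℝ)) * k θ) :
    Monotone k ∧ Monotone B := by
  have hk : Monotone k := by
    intro θ θ' hle
    rcases hle.eq_or_lt with rfl | hlt
    · exact le_rfl
    have hlt' : (θ : ℝ) < θ' := hlt
    have h1 := h θ θ'
    have h2 := h θ' θ
    by_contra hc
    rw [not_le] at hc
    -- The two constraints add up to `(θ' - θ) * (k θ - k θ') ≤ 0`.
    nlinarith [mul_pos (sub_pos.2 hlt') (sub_pos.2 hc)]
  refine ⟨hk, fun θ θ' hle => ?_⟩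
  have h1 := h θ' θ
  nlinarith [mul_nonneg (sub_nonneg.2 (hΘ θ' θ'.2).le) (sub_nonneg.2 (hk hle))]

/-- A positive density makes Lebesgue measure absolutely continuous with respect to the type
distribution. -/
theorem ae_comap_of_ae_typeDistribution {θlo θhi : ℝ} {f : Icc θlo θhi → ℝ} (hf : Measurable f)
    (hpos : ∀ θ, 0 < f θ) {p : Icc θlo θhi → Prop} (h : ∀ᵐ θ ∂(typeDistribution f), p θ) :
    ∀ᵐ θ ∂(Measure.comap Subtype.val (volume : Measure ℝ) : Measure (Icc θlo θhi)), p θ := by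
  refine (withDensity_absolutelyContinuous' hf.ennreal_ofReal.aemeasurable
    (ae_of_all _ fun θ => ?_)).ae_le h
  simpa using hpos θ



/-! ### The improved mechanism. -/

theorem proposition1
    (θlo θhi xlo xhi : ℝ) (hθlo : 0 < θlo) (hθ : θlo < θhi) (hθhi : θhi < 1) (hx : xlo ≤ xhi)
    (u : ℝ → ℝ) (hu_mono : StrictMono u) (hu_cont : Continuous u)
    (hu_conc : StrictConcaveOn ℝ Set.univ u)
    (K : ℝ → ℝ) (hK_mono : StrictMono K) (hK_conv : ConvexOn ℝ Set.univ K)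
    (z : ℝ → ℝ) (hz_diff : DifferentiableOn ℝ z (Set.Icc xlo xhi))
    (hz_mono : StrictMonoOn z (Set.Icc xlo xhi)) (hz_conv : ConvexOn ℝ (Set.Icc xlo xhi) z)
    (f : Set.Icc θlo θhi → ℝ) (hf_meas : Measurable f) (hf_pos : ∀ θ, 0 < f θ)
    (hF : MeasureTheory.IsProbabilityMeasure (typeDistribution f))
    (M : Mechanism (Set.Icc θlo θhi) (Set.Icc xlo xhi))
    (hM : M.Optimal u (meanCost K z) (typeDistribution f)) :
    (∀ᵐ θ ∂(MeasureTheory.Measure.comap Subtype.val MeasureTheory.volume :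
      MeasureTheory.Measure (Set.Icc θlo θhi)), IsDirac (M.action θ)) ∧
    ∃ M' : Mechanism (Set.Icc θlo θhi) (Set.Icc xlo xhi),
      M'.Optimal u (meanCost K z) (typeDistribution f) ∧
      (∀ θ, IsDirac (M'.action θ)) ∧
      ∀ θ, IsDirac (M.action θ) → M'.wage θ = M.wage θ ∧ M'.action θ = M.action θ := by
  classical
  obtain ⟨⟨hIC, hIR, hInt⟩, hbest⟩ := hM
  have hZ : Monotone (fun y : Icc xlo xhi => z y) :=
    fun y y' h => hz_mono.monotoneOn y.2 y'.2 h
  have hZc : Continuous (fun y : Icc xlo xhi => z y) := hz_diff.continuousOn.domRestrict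
  choose X hX using fun θ => hZ.exists_eq_integral hx hZc (M.action θ : Measure (Icc xlo xhi))
  choose c hc using fun θ => hu_mono.monotone.exists_certaintyEquivalent hx hu_cont
    (M.wage_mono θ) (M.action θ : Measure (Icc xlo xhi))
  have hUtil : ∀ θ, agentUtility u (meanCost K z) θ (M.wage θ) (M.action θ) =
      u (c θ) - (1 - (θ : ℝ)) * K (z (X θ)) := by
    intro θ
    simp only [agentUtility, meanCost, hX, hc]
  set x₀ : Icc xlo xhi := ⟨xlo, left_mem_Icc.2 hx⟩ with hx₀
  have hlc : ∀ θ, M.wage θ x₀ ≤ c θ := fun θ => hu_mono.le_iff_le.1 <|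
    (hc θ).symm ▸ (hu_mono.monotone.comp (M.wage_mono θ)).left_le_integral hx _
  let δ : Icc xlo xhi → ProbabilityMeasure (Icc xlo xhi) :=
    fun x => ⟨Measure.dirac x, inferInstance⟩
  let M' : Mechanism (Icc θlo θhi) (Icc xlo xhi) :=
    { wage := fun θ => if IsDirac (M.action θ) then M.wage θ
        else stepWage (M.wage θ x₀) (c θ) (X θ)
      wage_mono := fun θ => by
        split_ifs
        exacts [M.wage_mono θ, stepWage_monotone (hlc θ) _]
      wage_rightCts := fun θ => by
        split_ifs
        exacts [M.wage_rightCts θ, stepWage_rightCts _ _ _]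
      action := fun θ => if IsDirac (M.action θ) then M.action θ else δ (X θ) }
  have hM1 : ∀ θ, IsDirac (M.action θ) → M'.wage θ = M.wage θ ∧ M'.action θ = M.action θ :=
    fun θ h => ⟨if_pos h, if_pos h⟩
  have hM2 : ∀ θ, ¬ IsDirac (M.action θ) →
      M'.wage θ = stepWage (M.wage θ x₀) (c θ) (X θ) ∧ M'.action θ = δ (X θ) :=
    fun θ h => ⟨if_neg h, if_neg h⟩
  -- For an untouched type, injectivity of `z` and `u` identifies `X θ` with the atom and `c θ` with
  -- its wage, so one payoff formula serves all types.
  have hdirac : ∀ θ, (M'.action θ : Measure (Icc xlo xhi)) = Measure.dirac (X θ) ∧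
      M'.wage θ (X θ) = c θ := by
    intro θ
    by_cases h : IsDirac (M.action θ)
    · rw [(hM1 θ h).1, (hM1 θ h).2]
      obtain ⟨x, hxd⟩ := h
      have h1 := hX θ
      have h2 := hc θ
      rw [hxd, integral_dirac] at h1 h2
      have h3 : X θ = x := Subtype.ext (hz_mono.injOn (X θ).2 x.2 h1)
      rw [h3]
      exact ⟨hxd, (hu_mono.injective h2).symm⟩
    · rw [(hM2 θ h).1, (hM2 θ h).2]
      exact ⟨rfl, stepWage_self _ _ _⟩
  have hUtil1 : ∀ θ, agentUtility u (meanCost K z) θ (M'.wage θ) (M'.action θ) =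
      agentUtility u (meanCost K z) θ (M.wage θ) (M.action θ) := by
    intro θ
    rw [hUtil]
    simp only [agentUtility, meanCost, (hdirac θ).1, integral_dirac, (hdirac θ).2]
  have hpay : ∀ θ, M'.payoffAt θ = X θ - c θ := by
    intro θ
    simp only [Mechanism.payoffAt, (hdirac θ).1, integral_dirac, (hdirac θ).2]
  have hone : ∀ θ : Icc θlo θhi, 0 < 1 - (θ : ℝ) := fun θ => by linarith [θ.2.2]
  have hIC1 : M'.IncentiveCompatible u (meanCost K z) := by
    intro θ θ' ν
    rw [hUtil1]
    by_cases h : IsDirac (M.action θ')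
    · rw [(hM1 θ' h).1]
      exact hIC θ θ' ν
    · rw [(hM2 θ' h).1]
      obtain ⟨ν', h1, h2⟩ := exists_deviation hx (hu_mono.monotone.comp (M.wage_mono θ')) hZ
        (s := fun y => u (stepWage (M.wage θ' x₀) (c θ') (X θ') y)) (M.action θ') ν (hX θ')
        (fun y => by
          dsimp only [Function.comp_apply]
          rw [← hc θ', stepWage, apply_ite u])
      refine le_trans ?_ (hIC θ θ' ν')
      have h3 := mul_le_mul_of_nonneg_left (hK_mono.monotone h2) (hone θ).le
      have h4 : ∫ y, u (M.wage θ' y) ∂(ν' : Measure (Icc xlo xhi)) = _ := h1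
      simp only [agentUtility, meanCost, h4]
      linarith
  -- `X` and `c` come from choice, so their measurability in the type is not automatic; monotonicity
  -- supplies it, along with boundedness.
  have hmono := monotone_of_linear_incentive (Θ := Icc θlo θhi) (B := fun θ => u (c θ))
    (k := fun θ => K (z (X θ))) (fun θ h => h.2.trans_lt hθhi) (fun θ θ' => by
      have h := hIC θ θ' (M.action θ')
      rw [hUtil] at h
      simpa only [agentUtility, meanCost, ← hX, ← hc] using h)
  have hXmono : Monotone (fun θ => (X θ : ℝ)) := fun θ θ' h =>
    (hz_mono.le_iff_le (X θ).2 (X θ').2).1 (hK_mono.le_iff_le.1 (hmono.1 h))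
  have hcmono : Monotone c := fun θ θ' h => hu_mono.le_iff_le.1 (hmono.2 h)
  have hInt1 : Integrable M'.payoffAt (typeDistribution f) := by
    rw [funext hpay]
    exact (hXmono.integrable_Icc hθ.le _).sub (hcmono.integrable_Icc hθ.le _)
  have hlt : ∀ θ, ¬ IsDirac (M.action θ) → M.payoffAt θ < M'.payoffAt θ := by
    intro θ h
    rw [hpay]
    refine payoff_lt_of_not_isDirac hx hu_mono hu_cont hu_conc hz_diff.continuousOn hz_mono
      hz_conv (M.wage_mono θ) h (hX θ) (hc θ) fun y hy => ?_
    -- Producing `y` for sure under the type's own contract strictly saves cost, so it must strictly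
    -- lose gross utility.
    have h1 := hIC θ θ (δ y)
    rw [hUtil] at h1
    simp only [agentUtility, meanCost, δ, ProbabilityMeasure.coe_mk, integral_dirac] at h1
    have h2 := mul_lt_mul_of_pos_left (hK_mono hy) (hone θ)
    rw [← hc]
    linarith
  have hle : ∀ θ, M.payoffAt θ ≤ M'.payoffAt θ := by
    intro θ
    by_cases h : IsDirac (M.action θ)
    · simp only [Mechanism.payoffAt, hM1 θ h, le_refl]
    · exact (hlt θ h).le
  have hfeas : M'.Feasible u (meanCost K z) (typeDistribution f) :=
    ⟨hIC1, fun θ => (hUtil1 θ).symm ▸ hIR θ, hInt1⟩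
  have heq := (hbest M' hfeas).antisymm (integral_mono hInt hInt1 hle)
  refine ⟨ae_comap_of_ae_typeDistribution hf_meas hf_pos ?_, M', ⟨hfeas, fun N hN => ?_⟩,
    fun θ => ⟨X θ, (hdirac θ).1⟩, hM1⟩
  -- Pointwise ordered payoffs with equal integrals agree a.e., whereas they differ at every
  -- non-Dirac type.
  · filter_upwards [(integral_eq_iff_of_ae_le hInt hInt1 (ae_of_all _ hle)).1 heq.symm] with θ hθ
    by_contra h
    exact (hlt θ h).ne hθ
  · exact heq ▸ hbest N hN
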